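/- Let $m,n$ be natural numbers and equip the space $\mathbb{R}^{m\times n}$ of real $m\times n$ matrices with the norm $\|x\|=\sqrt{\operatorname{trace}(x^Tx)}$. For a set $\Omega\subset\mathbb{R}^{m\times n}$ and $x\in\mathbb{R}^{m\times n}$ let $$P_\Omega(x)=\{z\in\Omega : \|z-x\|\le\|y-x\|\text{ for all }y\in\Omega\}$$ be the (multivalued) metric projection of $x$ onto $\Omega$. A nonempty closed set $\Omega\subset\mathbb{R}^{m\times n}$ is called prox-regular at a point $\bar x\in\Omega$ if $P_\Omega$ is single-valued around $\bar x$, i.e. there is a neighbourhood $W$ of $\bar x$ in $\mathbb{R}^{m\times n}$ such that $P_\Omega(x)$ consists of exactly one point for every $x\in W$. Let $s\in\{0,1,\dots,\min\{m,n\}\}$ and $S=\{y\in\mathbb{R}^{m\times n} : \operatorname{rank}(y)\le s\}$. Then $S$ is prox-regular at every $\bar x\in\mathbb{R}^{m\times n}$ with $\operatorname{rank}(\bar x)=s$; that is, $S$ is nonempty and closed, $\bar x\in S$, and the metric projection $P_S$ is single-valued on a neighbourhood of $\bar x$. -/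

import Mathlib

open Topology
open scoped Matrix.Norms.Frobenius

/-- The (multivalued) metric projection of `x` onto `Ω`: the set of minimizers of `‖z - x‖`
over `z ∈ Ω`. -/
def metricProjection {X : Type*} [NormedAddCommGroup X] (Ω : Set X) (x : X) : Set X :=
  {z | z ∈ Ω ∧ ∀ y ∈ Ω, ‖z - x‖ ≤ ‖y - x‖}

/-- A nonempty closed set `Ω` is prox-regular at a point `xbar ∈ Ω` if the metric projection
onto `Ω` is single-valued on a neighbourhood of `xbar`, i.e. the projection of every point of some
neighbourhood of `xbar` in the whole space consists of exactly one point. -/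
structure ProxRegularAt {X : Type*} [NormedAddCommGroup X] (Ω : Set X) (xbar : X) : Prop where
  nonempty : Ω.Nonempty
  isClosed : IsClosed Ω
  mem : xbar ∈ Ω
  singleValued : ∃ W ∈ 𝓝 xbar, ∀ x ∈ W, ∃ z, metricProjection Ω x = {z}

/-- The lower level set `S = {y | rank y ≤ s}` of the rank function on real `m × n` matrices. -/
def rankLevelSet (m n s : ℕ) : Set (Matrix (Fin m) (Fin n) ℝ) :=
  {y | y.rank ≤ s}

/-- The norm in force on matrices is the one derived from the trace inner product. -/
theorem matrix_norm_eq_sqrt_trace {m n : ℕ} (x : Matrix (Fin m) (Fin n) ℝ) :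
    ‖x‖ = Real.sqrt (Matrix.trace (x.transpose * x)) := by
  rw [Matrix.frobenius_norm_def, Real.sqrt_eq_rpow, Finset.sum_comm]
  congr 1
  simp [Matrix.trace, Matrix.mul_apply, ← sq]

/-!
The set `S` of matrices of rank at most `s` is, near a matrix of rank exactly `s`, the image of a
smooth local retraction, and a closed set with a `C²` local retraction is prox-regular.

* *The retraction.* Since `xbar` has rank `s`, there are matrices `L` and `R` with
  `L * xbar * R = 1` of size `s × s` (`Matrix.exists_mul_mul_eq_one`). The skeleton map
  `z ↦ z R (L z R)⁻¹ L z` is then smooth near `xbar`, its values have rank at most `s`, and it fixes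
  every `z` of rank at most `s` for which `L z R` is invertible (`Matrix.skeleton_eq_self`).
* *Uniqueness of the projection.* A `C²` map `φ` commutes with taking midpoints up to an error
  `K ‖a - b‖²` (`exists_norm_midpoint_sub_midpoint_le_of_contDiffAt`). If `a`, `b` are two nearest
  points of `S` to `x`, at distance `d`, then by the parallelogram law their midpoint `c` satisfies
  `‖c - x‖² = d² - ‖a - b‖² / 4`. The point `φ c` of `S` lies within `K ‖a - b‖²` of `c`, and so
  would be closer to `x` than `d` as soon as `8 K d < 1`, unless `a = b`
  (`ProxRegularAt.of_contDiffAt_retraction`).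

Closedness of `S` rests on the same matrices `L`, `R`: if `y` has rank `r`, then
`det (L z R) ≠ 0` is an open condition on `z` that holds at `y` and forces `r ≤ rank z`.
Existence of the projection is the properness of finite-dimensional spaces.
-/

/-! ### Closed sets with a `C²` local retraction -/

/-- A `C²` map commutes with midpoints up to a quadratic error, locally uniformly. -/
theorem exists_norm_midpoint_sub_midpoint_le_of_contDiffAt {E F : Type*} [NormedAddCommGroup E]
    [NormedSpace ℝ E] [NormedAddCommGroup F] [NormedSpace ℝ F] {f : E → F} {x : E}
    (hf : ContDiffAt ℝ 2 f x) :
    ∃ K > (0 : ℝ), ∃ r > (0 : ℝ), ∀ a ∈ Metric.ball x r, ∀ b ∈ Metric.ball x r,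
      ‖f (midpoint ℝ a b) - midpoint ℝ (f a) (f b)‖ ≤ K * ‖a - b‖ ^ 2 := by
  obtain ⟨K, t, ht, hK⟩ :=
    (hf.fderiv_right (m := 1) (by norm_num [one_add_one_eq_two])).exists_lipschitzOnWith
  have hd : ∀ᶠ y in 𝓝 x, DifferentiableAt ℝ f y :=
    (hf.eventually (by simp)).mono fun y hy => hy.differentiableAt two_ne_zero
  obtain ⟨r, hr, hball⟩ := Metric.mem_nhds_iff.1 (Filter.inter_mem ht hd)
  refine ⟨K + 1, by positivity, r, hr, fun a ha b hb => ?_⟩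
  set c := midpoint ℝ a b with hc
  have hseg : segment ℝ a b ⊆ Metric.ball x r := (convex_ball x r).segment_subset ha hb
  have hcs : c ∈ segment ℝ a b := midpoint_mem_segment a b
  have key : ∀ y ∈ segment ℝ a b,
      ‖f y - f c - fderiv ℝ f c (y - c)‖ ≤ K * ‖a - b‖ * ‖y - c‖ := by
    intro y hy
    refine (convex_segment a b).norm_image_sub_le_of_norm_fderiv_le'
      (fun z hz => (hball (hseg hz)).2) (fun z hz => ?_) hcs hy
    refine (hK.norm_sub_le (hball (hseg hz)).1 (hball (hseg hcs)).1).trans ?_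
    gcongr
    rw [← dist_eq_norm, ← dist_eq_norm]
    have h1 := (convex_closedBall c (dist a b / 2)).segment_subset
      (x := a) (y := b) (by simp [hc, dist_left_midpoint]; linarith)
      (by simp [hc, dist_right_midpoint]; linarith) hz
    have h2 : dist z c ≤ dist a b / 2 := h1
    linarith [dist_nonneg (x := a) (y := b)]
  have ea := key a (left_mem_segment ℝ a b)
  have eb := key b (right_mem_segment ℝ a b)
  have na : ‖a - c‖ = ‖a - b‖ / 2 := by
    rw [← dist_eq_norm, hc, dist_left_midpoint, dist_eq_norm]; norm_num; ring
  have nb : ‖b - c‖ = ‖a - b‖ / 2 := by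
    rw [← dist_eq_norm, hc, dist_right_midpoint, dist_eq_norm]; norm_num; ring
  -- The first-order terms cancel, because `a - c` and `b - c` are opposite.
  have hlin : fderiv ℝ f c (a - c) + fderiv ℝ f c (b - c) = 0 := by
    rw [← map_add]
    have : a - c + (b - c) = 0 := by
      rw [hc, midpoint_eq_smul_add, invOf_eq_inv]; module
    rw [this, map_zero]
  have hid : f c - midpoint ℝ (f a) (f b) =
      (-(1 / 2) : ℝ) • ((f a - f c - fderiv ℝ f c (a - c)) + (f b - f c - fderiv ℝ f c (b - c))) := by
    rw [eq_neg_of_add_eq_zero_left hlin, midpoint_eq_smul_add, invOf_eq_inv]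
    module
  have hhalf : ‖(-(1 / 2) : ℝ)‖ = 1 / 2 := by norm_num
  rw [hid, norm_smul, hhalf]
  have htri := norm_add_le (f a - f c - fderiv ℝ f c (a - c)) (f b - f c - fderiv ℝ f c (b - c))
  rw [na] at ea
  rw [nb] at eb
  nlinarith [sq_nonneg ‖a - b‖]

/-- A closed set of a finite-dimensional inner product space is prox-regular at `xbar` if some map
that is `C²` at `xbar` sends a neighbourhood of `xbar` into the set and fixes the points of the set
in that neighbourhood. -/
theorem ProxRegularAt.of_contDiffAt_retraction {E : Type*} [NormedAddCommGroup E]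
    [InnerProductSpace ℝ E] [ProperSpace E] {S : Set E} {xbar : E} (hS : IsClosed S)
    (hx : xbar ∈ S) {φ : E → E} (hφ : ContDiffAt ℝ 2 φ xbar) (hmaps : ∀ᶠ z in 𝓝 xbar, φ z ∈ S)
    (hfix : ∀ᶠ z in 𝓝 xbar, z ∈ S → φ z = z) : ProxRegularAt S xbar := by
  refine ⟨⟨xbar, hx⟩, hS, hx, ?_⟩
  obtain ⟨K, hK, r₁, hr₁, hmid⟩ := exists_norm_midpoint_sub_midpoint_le_of_contDiffAt hφ
  obtain ⟨r₂, hr₂, hball⟩ := Metric.eventually_nhds_iff_ball.1 (hmaps.and hfix)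
  refine ⟨Metric.ball xbar (min (min r₁ r₂ / 2) (1 / (8 * K))),
    Metric.ball_mem_nhds _ (by positivity), fun x hxW => ?_⟩
  rw [Metric.mem_ball, lt_min_iff] at hxW
  obtain ⟨hxr, hxK⟩ := hxW
  -- A projection of `x` is at most as far from `x` as `xbar`, so it stays near `xbar`.
  have hproj : ∀ z ∈ metricProjection S x, ‖z - x‖ < 1 / (8 * K) ∧
      z ∈ Metric.ball xbar r₁ ∧ z ∈ Metric.ball xbar r₂ := by
    intro z hz
    have h1 := hz.2 xbar hx
    rw [← dist_eq_norm, ← dist_eq_norm, dist_comm xbar x] at h1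
    have h2 := dist_triangle z x xbar
    rw [Metric.mem_ball, Metric.mem_ball, ← dist_eq_norm, ← lt_min_iff]
    exact ⟨by linarith, by linarith⟩
  obtain ⟨z, hzS, hzd⟩ := hS.exists_infDist_eq_dist ⟨xbar, hx⟩ x
  have hz : z ∈ metricProjection S x := by
    refine ⟨hzS, fun y hy => ?_⟩
    rw [← dist_eq_norm, ← dist_eq_norm, dist_comm z, dist_comm y, ← hzd]
    exact Metric.infDist_le_dist_of_mem hy
  refine ⟨z, Set.Subset.antisymm (fun y hy => ?_) (Set.singleton_subset_iff.2 hz)⟩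
  rw [Set.mem_singleton_iff]
  by_contra hne
  obtain ⟨hyd, hy1, hy2⟩ := hproj y hy
  obtain ⟨-, hz1, hz2⟩ := hproj z hz
  have hdeq : ‖z - x‖ = ‖y - x‖ := le_antisymm (hz.2 y hy.1) (hy.2 z hz.1)
  set c := midpoint ℝ y z with hc
  have hcS : φ c ∈ S :=
    (hball c ((convex_ball xbar r₂).segment_subset hy2 hz2 (midpoint_mem_segment y z))).1
  have hφc : ‖φ c - c‖ ≤ K * ‖y - z‖ ^ 2 := by
    have := hmid y hy1 z hz1
    rwa [(hball y hy2).2 hy.1, (hball z hz2).2 hz.1] at this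
  have hle : ‖y - x‖ ≤ ‖c - x‖ + K * ‖y - z‖ ^ 2 := by
    have h1 := hy.2 _ hcS
    have h2 := norm_add_le (φ c - c) (c - x)
    rw [sub_add_sub_cancel] at h2
    linarith
  have hpar : ‖c - x‖ ^ 2 = ‖y - x‖ ^ 2 - ‖y - z‖ ^ 2 / 4 := by
    have h := parallelogram_law_with_norm ℝ (y - x) (z - x)
    have h1 : y - x + (z - x) = (2 : ℝ) • (c - x) := by
      rw [hc, midpoint_eq_smul_add, invOf_eq_inv]; module
    rw [h1, sub_sub_sub_cancel_right, norm_smul, hdeq] at h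
    norm_num at h
    nlinarith
  have hpos : 0 < ‖y - z‖ ^ 2 := by
    have := norm_pos_iff.2 (sub_ne_zero.2 hne)
    positivity
  have hcd : ‖c - x‖ ≤ ‖y - x‖ :=
    le_of_sq_le_sq (by linarith) (norm_nonneg _)
  -- `‖y - z‖² / 4 = (d - ‖c - x‖) (d + ‖c - x‖) ≤ K ‖y - z‖² * 2 d`, where `d = ‖y - x‖`.
  have h1 : ‖y - z‖ ^ 2 / 4 ≤ K * ‖y - z‖ ^ 2 * (2 * ‖y - x‖) := by
    calc ‖y - z‖ ^ 2 / 4 = (‖y - x‖ - ‖c - x‖) * (‖y - x‖ + ‖c - x‖) := by linarith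
      _ ≤ K * ‖y - z‖ ^ 2 * (2 * ‖y - x‖) := by
        gcongr
        · linarith
        · linarith
  have h2 : ‖y - x‖ * (8 * K) < 1 := (lt_div_iff₀ (by positivity)).1 hyd
  nlinarith

/-! ### Skeleton decomposition of matrices of bounded rank -/

namespace Matrix

/-- A matrix of rank `r` is carried to the `r × r` identity by suitable left and right factors. -/
theorem exists_mul_mul_eq_one {m n r : ℕ} (M : Matrix (Fin m) (Fin n) ℝ) (hM : M.rank = r) :
    ∃ (L : Matrix (Fin r) (Fin m) ℝ) (R : Matrix (Fin n) (Fin r) ℝ), L * M * R = 1 := by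
  obtain ⟨b⟩ : Nonempty (Module.Basis (Fin r) ℝ M.mulVecLin.range) :=
    ⟨Module.finBasisOfFinrankEq ℝ M.mulVecLin.range hM⟩
  have hb : ∀ i, ∃ v, M *ᵥ v = (b i : Fin m → ℝ) := fun i => (b i).2
  choose v hv using hb
  let R : Matrix (Fin n) (Fin r) ℝ := of fun j i => v i j
  have hcol : (M * R).col = fun i => (b i : Fin m → ℝ) := by
    funext i
    rw [← hv i]
    rfl
  have hli : LinearIndependent ℝ (M * R).col := by
    rw [hcol]
    exact b.linearIndependent.map' M.mulVecLin.range.subtype (Submodule.ker_subtype _)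
  obtain ⟨g, hg⟩ := (toLin' (M * R)).exists_leftInverse_of_injective
    (LinearMap.ker_eq_bot.2 (mulVec_injective_iff.2 hli))
  refine ⟨LinearMap.toMatrix' g, R, ?_⟩
  rw [Matrix.mul_assoc, ← LinearMap.toMatrix'_toLin' (M * R), ← LinearMap.toMatrix'_comp, hg,
    LinearMap.toMatrix'_id]

/-- If a product `L * z * R` of size `r × r` is invertible, then `z` has rank at least `r`. -/
theorem le_rank_of_isUnit_det_mul_mul {m n r : ℕ} {z : Matrix (Fin m) (Fin n) ℝ}
    {L : Matrix (Fin r) (Fin m) ℝ} {R : Matrix (Fin n) (Fin r) ℝ}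
    (h : IsUnit (L * z * R).det) : r ≤ z.rank := by
  have h1 : (L * z * R).rank = r := by
    simpa using rank_of_isUnit _ ((isUnit_iff_isUnit_det _).2 h)
  rw [← h1]
  exact (rank_mul_le_left _ _).trans (rank_mul_le_right _ _)

/-- A matrix of rank at most `r` is recovered from the products `z * R` and `L * z` whenever the
`r × r` matrix `L * z * R` is invertible. -/
theorem skeleton_eq_self {m n r : ℕ} {z : Matrix (Fin m) (Fin n) ℝ}
    {L : Matrix (Fin r) (Fin m) ℝ} {R : Matrix (Fin n) (Fin r) ℝ} (hz : z.rank ≤ r)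
    (h : IsUnit (L * z * R).det) : z * R * (L * z * R)⁻¹ * (L * z) = z := by
  have hrank : z.rank ≤ (z * R).rank := by
    refine hz.trans (le_rank_of_isUnit_det_mul_mul (L := L) (R := 1) ?_)
    rwa [Matrix.mul_one, ← Matrix.mul_assoc]
  have hle : (z * R).mulVecLin.range ≤ z.mulVecLin.range := by
    rw [mulVecLin_mul]
    exact LinearMap.range_comp_le_range _ _
  -- The columns of `z * R` span the column space of `z`, so `z = z * R * Y` for some `Y`.
  have hrange := Submodule.eq_of_le_of_finrank_le hle hrank
  have hsol : ∀ j, ∃ y, (z * R) *ᵥ y = z.col j := fun j => by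
    have : z.col j ∈ (z * R).mulVecLin.range := by
      rw [hrange]
      exact ⟨Pi.single j 1, by simp⟩
    exact this
  choose y hy using hsol
  have hY : z * R * (of fun i j => y j i) = z := by
    ext i j
    exact congrFun (hy j) i
  have hLz : (L * z * R)⁻¹ * (L * z) = of fun i j => y j i := by
    have hA : L * z = L * z * R * (of fun i j => y j i) := by
      rw [Matrix.mul_assoc L z R, Matrix.mul_assoc L, hY]
    exact (congrArg _ hA).trans (nonsing_inv_mul_cancel_left _ _ h)
  rw [Matrix.mul_assoc _ _ (L * z), hLz, hY]

/-! ### Topology and smoothness for the Frobenius norm -/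

theorem isOpen_isUnit_det_mul_mul {m n r : ℕ} (L : Matrix (Fin r) (Fin m) ℝ)
    (R : Matrix (Fin n) (Fin r) ℝ) :
    IsOpen {z : Matrix (Fin m) (Fin n) ℝ | IsUnit (L * z * R).det} := by
  simp_rw [isUnit_iff_ne_zero]
  exact isOpen_ne_fun (by fun_prop) continuous_const

theorem isBoundedBilinearMap_mul (l m n : ℕ) :
    IsBoundedBilinearMap ℝ
      fun p : Matrix (Fin l) (Fin m) ℝ × Matrix (Fin m) (Fin n) ℝ => p.1 * p.2 where
  add_left := Matrix.add_mul
  smul_left := Matrix.smul_mul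
  add_right := Matrix.mul_add
  smul_right c x y := Matrix.mul_smul x c y
  bound := ⟨1, one_pos, fun x y => by simpa using frobenius_norm_mul x y⟩

theorem contDiffAt_mul {E : Type*} [NormedAddCommGroup E] [NormedSpace ℝ E] {l m n : ℕ}
    {k : WithTop ℕ∞} {f : E → Matrix (Fin l) (Fin m) ℝ} {g : E → Matrix (Fin m) (Fin n) ℝ} {x : E}
    (hf : ContDiffAt ℝ k f x) (hg : ContDiffAt ℝ k g x) :
    ContDiffAt ℝ k (fun y => f y * g y) x :=
  (isBoundedBilinearMap_mul l m n).contDiff.contDiffAt.comp x (hf.prodMk hg)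

theorem contDiffAt_inv {E : Type*} [NormedAddCommGroup E] [NormedSpace ℝ E] {r : ℕ}
    {k : WithTop ℕ∞} {f : E → Matrix (Fin r) (Fin r) ℝ} {x : E} (hf : ContDiffAt ℝ k f x)
    (hu : IsUnit (f x)) : ContDiffAt ℝ k (fun y => (f y)⁻¹) x := by
  have : CompleteSpace (Matrix (Fin r) (Fin r) ℝ) := FiniteDimensional.complete ℝ _
  obtain ⟨u, hu⟩ := hu
  simp_rw [nonsing_inv_eq_ringInverse]
  have h : ContDiffAt ℝ k Ring.inverse (f x) := hu ▸ contDiffAt_ringInverse ℝ u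
  exact h.comp x hf

theorem frobenius_parallelogram {m n : ℕ} (x y : Matrix (Fin m) (Fin n) ℝ) :
    ‖x + y‖ * ‖x + y‖ + ‖x - y‖ * ‖x - y‖ = 2 * (‖x‖ * ‖x‖ + ‖y‖ * ‖y‖) := by
  have h : ∀ z : Matrix (Fin m) (Fin n) ℝ, ‖z‖ * ‖z‖ = ∑ i, ∑ j, z i j * z i j := fun z => by
    rw [frobenius_norm_def, ← Real.sqrt_eq_rpow, Real.mul_self_sqrt (by positivity)]
    simp [← sq]
  simp_rw [h, ← Finset.sum_add_distrib, Finset.mul_sum]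
  refine Finset.sum_congr rfl fun i _ => Finset.sum_congr rfl fun j _ => ?_
  simp only [add_apply, sub_apply]
  ring

end Matrix

theorem isClosed_rankLevelSet (m n s : ℕ) : IsClosed (rankLevelSet m n s) := by
  rw [← isOpen_compl_iff, isOpen_iff_mem_nhds]
  intro y hy
  obtain ⟨L, R, hLR⟩ := y.exists_mul_mul_eq_one rfl
  filter_upwards [(Matrix.isOpen_isUnit_det_mul_mul L R).mem_nhds (by simp [hLR])] with z hz hzs
  exact hy ((Matrix.le_rank_of_isUnit_det_mul_mul hz).trans hzs)

theorem proposition3p6 (m n s : ℕ) (xbar : Matrix (Fin m) (Fin n) ℝ) (hx : xbar.rank = s) :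
    ProxRegularAt (rankLevelSet m n s) xbar := by
  let _ : InnerProductSpace ℝ (Matrix (Fin m) (Fin n) ℝ) :=
    InnerProductSpace.ofNorm ℝ Matrix.frobenius_parallelogram
  have : ProperSpace (Matrix (Fin m) (Fin n) ℝ) := FiniteDimensional.proper ℝ _
  obtain ⟨L, R, hLR⟩ := xbar.exists_mul_mul_eq_one hx
  have hmul := fun {l k p : ℕ} {f : Matrix (Fin m) (Fin n) ℝ → Matrix (Fin l) (Fin k) ℝ}
    {g : Matrix (Fin m) (Fin n) ℝ → Matrix (Fin k) (Fin p) ℝ} =>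
    Matrix.contDiffAt_mul (k := 2) (f := f) (g := g) (x := xbar)
  have hLz : ContDiffAt ℝ 2 (fun z => L * z) xbar := hmul contDiffAt_const contDiffAt_id
  have hzR : ContDiffAt ℝ 2 (fun z => z * R) xbar := hmul contDiffAt_id contDiffAt_const
  have hinv : ContDiffAt ℝ 2 (fun z => (L * z * R)⁻¹) xbar :=
    Matrix.contDiffAt_inv (hmul hLz contDiffAt_const) (by rw [hLR]; exact isUnit_one)
  refine ProxRegularAt.of_contDiffAt_retraction (isClosed_rankLevelSet m n s) hx.le
    (φ := fun z => z * R * (L * z * R)⁻¹ * (L * z)) (hmul (hmul hzR hinv) hLz) ?_ ?_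
  · refine Filter.Eventually.of_forall fun z => ?_
    -- The product factors through `ℝ ^ s`.
    exact (Matrix.rank_mul_le_left _ _).trans <| (Matrix.rank_mul_le_right _ _).trans <|
      by simpa using Matrix.rank_le_width (L * z * R)⁻¹
  · filter_upwards [(Matrix.isOpen_isUnit_det_mul_mul L R).mem_nhds (by simp [hLR])] with z hz hzs
    exact Matrix.skeleton_eq_self hzs hz
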